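/- Let $k\ge 2$ be an integer, let $\Sigma$ be a totally ordered alphabet, and let $\mathbf{x}=a_0a_1a_2\cdots$ be a $k$-automatic sequence over $\Sigma$, i.e. there is a deterministic finite automaton with outputs associated with its states that, on reading the base-$k$ representation of $n$ (most significant digit first), reaches a state with output $a_n$, for every $n\ge 0$. Words over $\Sigma$ are ordered lexicographically, a proper prefix of a word being smaller than the word. A nonempty word is Lyndon if it is primitive (not of the form $y^m$ with $m\ge 2$) and lexicographically least among all its conjugates. Every nonempty finite word $w$ can be written in a unique way as $w=w_1w_2\cdots w_m$ with Lyndon words $w_1\ge w_2\ge\cdots\ge w_m$; this is its Lyndon factorization, and $m$ is its number of terms. Then the sequence $(f(n))_{n\ge 0}$ defined by $$f(n)=\text{the number of terms in the Lyndon factorization of the prefix } \mathbf{x}[0..n]=a_0a_1\cdots a_n$$ is $k$-regular: there are an integer $d\ge 0$, a row vector $u\in\mathbb{N}^{1\times d}$, a column vector $v\in\mathbb{N}^{d\times 1}$ and a matrix-valued morphism $\mu:\{0,1,\dots,k-1\}^*\to\mathbb{N}^{d\times d}$ such that $f(n)=u\,\mu(w)\,v$ for every $n\ge 0$, where $w$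 is the base-$k$ representation of $n$ (most significant digit first; the empty word for $n=0$). -/

import Mathlib

namespace LyndonAutomatic

/-- The canonical base-`k` representation of `n`, most significant digit first, without leading
zeros, as a word over the alphabet `{0, …, k-1}`. The number `0` is represented by the empty
word. -/
def baseRep (k : ℕ) (hk : 2 ≤ k) (n : ℕ) : List (Fin k) :=
  (Nat.digits k n).reverse.pmap (fun d h => (⟨d, h⟩ : Fin k))
    (fun _ hd => Nat.digits_lt_base hk (List.mem_reverse.mp hd))

/-- A deterministic automaton with input alphabet `I`, state set `σ` and outputs in `α`
associated with the states. -/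
structure DFAO (I : Type*) (σ : Type*) (α : Type*) where
  /-- the transition function -/
  step : σ → I → σ
  /-- the initial state -/
  start : σ
  /-- the output map -/
  output : σ → α

/-- The output of the state that the automaton reaches after reading `w` from left to right. -/
def DFAO.run {I σ α : Type*} (M : DFAO I σ α) (w : List I) : α :=
  M.output (w.foldl M.step M.start)

/-- `x` is `k`-automatic: a finite automaton with output, on reading `n` in base `k`, reaches a
state with output `x n`. -/
def IsAutomatic {α : Type*} (k : ℕ) (hk : 2 ≤ k) (x : ℕ → α) : Prop :=
  ∃ (σ : Type) (_ : Finite σ) (M : DFAO (Fin k) σ α), ∀ n, M.run (baseRep k hk n) = x n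

/-- `a` is `k`-regular: there are a row vector `u`, a column vector `v` and a matrix-valued
morphism `μ` on words over `{0, …, k-1}` (given by its values on the letters), all with entries in
`ℕ`, such that `a n = u μ(w) v` where `w` is the base-`k` representation of `n`. -/
def IsRegular (k : ℕ) (hk : 2 ≤ k) (a : ℕ → ℕ) : Prop :=
  ∃ (d : ℕ) (u v : Fin d → ℕ) (μ : Fin k → Matrix (Fin d) (Fin d) ℕ),
    ∀ n, a n = u ⬝ᵥ (((baseRep k hk n).map μ).prod.mulVec v)

/-- `w` is a power: it is nonempty and of the form `y ^ m` with `m ≥ 2`. -/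
def IsPower {α : Type*} (w : List α) : Prop :=
  w ≠ [] ∧ ∃ (y : List α) (m : ℕ), 2 ≤ m ∧ w = (List.replicate m y).flatten

/-- `w` is primitive: it is nonempty and not a power. -/
def IsPrimitive {α : Type*} (w : List α) : Prop :=
  w ≠ [] ∧ ¬ IsPower w

/-- `w` and `z` are conjugates. -/
def IsConjugate {α : Type*} (w z : List α) : Prop :=
  ∃ u v : List α, w = u ++ v ∧ z = v ++ u

/-- `w` is a Lyndon word: primitive and lexicographically least among its conjugates. (The order
on `List α` is the lexicographic one, a proper prefix being smaller.) -/
def IsLyndon {α : Type*} [LinearOrder α] (w : List α) : Prop :=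
  IsPrimitive w ∧ ∀ z, IsConjugate w z → w ≤ z

/-- `ws = [w₁, …, wₘ]` is a Lyndon factorization of `w`: `w = w₁ ⋯ wₘ` with every `wᵢ` a Lyndon
word and `w₁ ≥ w₂ ≥ ⋯ ≥ wₘ`. -/
def IsLyndonFactorization {α : Type*} [LinearOrder α] (w : List α) (ws : List (List α)) : Prop :=
  ws.flatten = w ∧ (∀ y ∈ ws, IsLyndon y) ∧ ws.IsChain (fun y z => z ≤ y)

/-- The word `x[0..n] = x 0, x 1, …, x n`, of length `n + 1`. -/
def prefixWord {α : Type*} (x : ℕ → α) (n : ℕ) : List α :=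
  (List.range (n + 1)).map x

end LyndonAutomatic

/-! The number of Lyndon factors of a word `w` equals the number of positions `i` at which the
suffix of `w` is smaller than every longer suffix: these are exactly the starting points of the
factors (`IsLyndonFactorization.length_eq`). Indeed a Lyndon word is smaller than its proper
suffixes, so no record occurs strictly inside a factor, while deleting the first factor makes the
word smaller.

For `w = x[0..n]` this condition on `(i, n)` is first-order in comparisons of letters of `x` and
inequalities between sums of indices. Such relations have a finite `k`-kernel, because finite
kernels survive Boolean operations and quantification. Counting the `i ≤ n` that satisfy such a
relation obeys a linear recurrence in the last digit of `n` (`HasFiniteKernel.isRegular_count`),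
hence the count is regular. -/

namespace LyndonAutomatic

/-! ### Finite kernels and automatic relations -/

section Automata

/-- The digit-by-digit extension of `n`: appending the digit `s` to the base-`k` representation. -/
theorem baseRep_mul_add {k : ℕ} (hk : 2 ≤ k) (n : ℕ) (s : Fin k) (h : k * n + s ≠ 0) :
    baseRep k hk (k * n + s) = baseRep k hk n ++ [s] := by
  have hd : Nat.digits k (k * n + s) = (s : ℕ) :: Nat.digits k n := by
    rw [add_comm]
    refine Nat.digits_add k (by omega) s n s.2 ?_
    by_contra hc
    push Not at hc
    simp [hc.1, hc.2] at h
  simp [baseRep, hd]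

/-- Induction on the number of base-`k` digits. -/
theorem induction_on_digits {k : ℕ} (hk : 2 ≤ k) {p : ℕ → Prop} (h0 : p 0)
    (hs : ∀ n (s : Fin k), k * n + s ≠ 0 → p n → p (k * n + s)) (n : ℕ) : p n := by
  induction n using Nat.strong_induction_on with
  | _ n ih =>
    rcases eq_or_ne n 0 with rfl | hn
    · exact h0
    have := hs (n / k) ⟨n % k, Nat.mod_lt _ (by omega)⟩ (by simpa [Nat.div_add_mod] using hn)
      (ih _ (Nat.div_lt_self (Nat.pos_of_ne_zero hn) (by omega)))
    simpa [Nat.div_add_mod] using this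

/-- An automatic sequence has a finite `k`-kernel. -/
theorem IsAutomatic.exists_finite_kernel {α : Type*} {k : ℕ} {hk : 2 ≤ k} {x : ℕ → α}
    (hx : IsAutomatic k hk x) :
    ∃ K : Set (ℕ → α), K.Finite ∧ x ∈ K ∧
      ∀ g ∈ K, ∀ r < k, (fun n => g (k * n + r)) ∈ K := by
  obtain ⟨σ, _, M, hM⟩ := hx
  let state : ℕ → σ := fun n => (baseRep k hk n).foldl M.step M.start
  -- Zero needs its own state `p.2`: it is read as the empty word, and the automaton may react to
  -- leading zeros.
  let g : (σ → σ) × σ → ℕ → α := fun p n => M.output (if n = 0 then p.2 else p.1 (state n))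
  have hstate : ∀ n (s : Fin k), k * n + s ≠ 0 → state (k * n + s) = M.step (state n) s := by
    intro n s h
    simp [state, baseRep_mul_add hk n s h]
  refine ⟨Set.range g, Set.finite_range g, ⟨(id, state 0), ?_⟩, ?_⟩
  · funext n
    rw [← hM n]
    by_cases h : n = 0
    · simp [g, h, state, DFAO.run]
    · simp [g, h, state, DFAO.run]
  · rintro _ ⟨⟨τ, c⟩, rfl⟩ r hr
    refine ⟨(fun q => τ (M.step q ⟨r, hr⟩), if r = 0 then c else τ (state r)), ?_⟩
    funext n
    by_cases h : n = 0
    · simp [g, h]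
    · have h' : k * n + r ≠ 0 := by
        have : k * n ≠ 0 := mul_ne_zero (by omega) h
        omega
      have := hstate n ⟨r, hr⟩ h'
      simp only at this
      simp only [g, h, h', if_false, this]

variable {ι β : Type*} {k : ℕ}

/-- A function of several natural numbers is `k`-automatic: it lies in a finite set of functions
that is closed under substituting `k * v i + r i` for each variable `v i`. -/
def HasFiniteKernel (k : ℕ) (F : (ι → ℕ) → β) : Prop :=
  ∃ K : Set ((ι → ℕ) → β), K.Finite ∧ F ∈ K ∧
    ∀ G ∈ K, ∀ r : ι → ℕ, (∀ i, r i < k) → (fun v => G fun i => k * v i + r i) ∈ K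

theorem HasFiniteKernel.comp {γ : Type*} {F : (ι → ℕ) → β} (hF : HasFiniteKernel k F)
    (f : β → γ) : HasFiniteKernel k fun v => f (F v) := by
  obtain ⟨K, hK, hFK, hc⟩ := hF
  refine ⟨(fun G v => f (G v)) '' K, hK.image _, ⟨F, hFK, rfl⟩, ?_⟩
  rintro _ ⟨G, hG, rfl⟩ r hr
  exact ⟨_, hc G hG r hr, rfl⟩

theorem HasFiniteKernel.comp₂ {γ δ : Type*} {F : (ι → ℕ) → β} {G : (ι → ℕ) → γ}
    (hF : HasFiniteKernel k F) (hG : HasFiniteKernel k G) (f : β → γ → δ) :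
    HasFiniteKernel k fun v => f (F v) (G v) := by
  obtain ⟨K, hK, hFK, hc⟩ := hF
  obtain ⟨L, hL, hGL, hd⟩ := hG
  refine ⟨Set.image2 (fun P Q v => f (P v) (Q v)) K L, hK.image2 _ hL,
    ⟨F, hFK, G, hGL, rfl⟩, ?_⟩
  rintro _ ⟨P, hP, Q, hQ, rfl⟩ r hr
  exact ⟨_, hc P hP r hr, _, hd Q hQ r hr, rfl⟩

theorem HasFiniteKernel.subst {κ : Type*} {F : (ι → ℕ) → β} (hF : HasFiniteKernel k F)
    (σ : ι → κ) : HasFiniteKernel k fun v : κ → ℕ => F (v ∘ σ) := by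
  obtain ⟨K, hK, hFK, hc⟩ := hF
  refine ⟨(fun G v => G (v ∘ σ)) '' K, hK.image _, ⟨F, hFK, rfl⟩, ?_⟩
  rintro _ ⟨G, hG, rfl⟩ r hr
  exact ⟨_, hc G hG (r ∘ σ) fun i => hr (σ i), rfl⟩

/-- Automatic predicates are closed under existential quantification. -/
theorem HasFiniteKernel.exists [DecidableEq ι] (hk : 2 ≤ k) {F : (ι → ℕ) → Prop}
    (hF : HasFiniteKernel k F) (i : ι) :
    HasFiniteKernel k fun v => ∃ y, F (Function.update v i y) := by
  obtain ⟨K, hK, hFK, hc⟩ := hF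
  -- Subset construction: guess the last digit `s` of the witness `y` and keep the set `T` of all
  -- relations that may remain.
  refine ⟨(fun (T : Set ((ι → ℕ) → Prop)) v => ∃ G ∈ T, ∃ y, G (Function.update v i y)) ''
    𝒫 K, hK.finite_subsets.image _, ⟨{F}, by simpa using hFK, by simp⟩, ?_⟩
  rintro _ ⟨T, hT, rfl⟩ r hr
  have hr' : ∀ s < k, ∀ l, Function.update r i s l < k := by
    intro s hs l
    by_cases hl : l = i
    · subst hl
      simpa using hs
    · simpa [hl] using hr l
  have hup : ∀ (v : ι → ℕ) y s, (Function.update (fun l => k * v l + r l) i (k * y + s)) =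
      fun l => k * Function.update v i y l + Function.update r i s l := by
    intro v y s
    funext l
    by_cases hl : l = i
    · subst hl
      simp
    · simp [hl]
  refine ⟨{H | ∃ G ∈ T, ∃ s < k, H = fun v => G fun l => k * v l + Function.update r i s l},
    ?_, ?_⟩
  · rintro _ ⟨G, hG, s, hs, rfl⟩
    exact hc G (hT hG) _ (hr' s hs)
  · funext v
    refine propext ⟨?_, ?_⟩
    · rintro ⟨_, ⟨G, hG, s, hs, rfl⟩, y, h⟩
      exact ⟨G, hG, k * y + s, by rwa [hup]⟩
    · rintro ⟨G, hG, y, h⟩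
      refine ⟨_, ⟨G, hG, y % k, Nat.mod_lt _ (by omega), rfl⟩, y / k, ?_⟩
      rwa [← hup, Nat.div_add_mod]

theorem HasFiniteKernel.not {F : (ι → ℕ) → Prop} (hF : HasFiniteKernel k F) :
    HasFiniteKernel k fun v => ¬ F v :=
  hF.comp Not

theorem HasFiniteKernel.and {F G : (ι → ℕ) → Prop} (hF : HasFiniteKernel k F)
    (hG : HasFiniteKernel k G) : HasFiniteKernel k fun v => F v ∧ G v :=
  hF.comp₂ hG And

theorem HasFiniteKernel.or {F G : (ι → ℕ) → Prop} (hF : HasFiniteKernel k F)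
    (hG : HasFiniteKernel k G) : HasFiniteKernel k fun v => F v ∨ G v :=
  hF.comp₂ hG Or

theorem hasFiniteKernel_add_le (hk : 2 ≤ k) (i j l : ι) :
    HasFiniteKernel k fun v : ι → ℕ => v i + v j ≤ v l := by
  refine ⟨(fun c (v : ι → ℕ) => v i + v j + c ≤ v l) '' Set.Iic 2, (Set.finite_Iic 2).image _,
    ⟨0, by simp, by simp⟩, ?_⟩
  rintro _ ⟨c, hc, rfl⟩ r hr
  have hi := hr i
  have hj := hr j
  have hl := hr l
  simp only [Set.mem_Iic] at hc
  have hdm := Nat.div_add_mod (r i + r j + c + (k - 1 - r l)) k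
  have hmod := Nat.mod_lt (r i + r j + c + (k - 1 - r l)) (by omega : 0 < k)
  -- The new carry is the ceiling of `(r i + r j + c - r l) / k`. The numerator here is at most `3 *
  -- k - 1` when `c ≤ 2`, so carries stay at most 2.
  set q := (r i + r j + c + (k - 1 - r l)) / k
  have key : ∀ v : ι → ℕ, (k * v i + r i + (k * v j + r j) + c ≤ k * v l + r l ↔
      v i + v j + q ≤ v l) := by
    intro v
    constructor
    · intro h
      by_contra hlt
      have := Nat.mul_le_mul_left k (show v l + 1 ≤ v i + v j + q by omega)
      simp only [mul_add, mul_one] at this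
      omega
    · intro h
      have := Nat.mul_le_mul_left k h
      simp only [mul_add] at this
      omega
  refine ⟨q, ?_, ?_⟩
  · simp only [Set.mem_Iic]
    by_contra hq
    have : k * 3 ≤ k * q := Nat.mul_le_mul_left k (by omega)
    omega
  · funext v
    exact propext (key v).symm

theorem hasFiniteKernel_lt (i j : ι) :
    HasFiniteKernel k fun v : ι → ℕ => v i < v j := by
  refine ⟨(fun c (v : ι → ℕ) => v i + c ≤ v j) '' Set.Iic 1, (Set.finite_Iic 1).image _,
    ⟨1, by simp, by simp only [Nat.add_one_le_iff]⟩, ?_⟩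
  rintro _ ⟨c, hc, rfl⟩ r hr
  have hi := hr i
  have hj := hr j
  simp only [Set.mem_Iic] at hc
  have key : ∀ v : ι → ℕ, (k * v i + r i + c ≤ k * v j + r j ↔
      v i + (if r i + c ≤ r j then 0 else 1) ≤ v j) := by
    intro v
    constructor
    · intro h
      by_contra hlt
      split_ifs at hlt with hrc
      · have := Nat.mul_le_mul_left k (show v j + 1 ≤ v i by omega)
        simp only [mul_add, mul_one] at this
        omega
      · have := Nat.mul_le_mul_left k (show v j ≤ v i by omega)
        omega
    · intro h
      have := Nat.mul_le_mul_left k h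
      split_ifs at this with hrc
      · simp only [add_zero] at this
        omega
      · simp only [mul_add, mul_one] at this
        omega
  refine ⟨if r i + c ≤ r j then 0 else 1, ?_, ?_⟩
  · simp only [Set.mem_Iic]
    split_ifs <;> omega
  · funext v
    exact propext (key v).symm

theorem IsAutomatic.hasFiniteKernel_add {hk : 2 ≤ k} {x : ℕ → β} (hx : IsAutomatic k hk x)
    (i j : ι) : HasFiniteKernel k fun v : ι → ℕ => x (v i + v j) := by
  obtain ⟨K, hK, hxK, hc⟩ := hx.exists_finite_kernel
  refine ⟨Set.image2 (fun g c (v : ι → ℕ) => g (v i + v j + c)) K (Set.Iic 1),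
    hK.image2 _ (Set.finite_Iic 1), ⟨x, hxK, 0, by simp, by simp⟩, ?_⟩
  rintro _ ⟨g, hg, c, hc1, rfl⟩ r hr
  have hi := hr i
  have hj := hr j
  simp only [Set.mem_Iic] at hc1
  have hdm := Nat.div_add_mod (r i + r j + c) k
  have hmod := Nat.mod_lt (r i + r j + c) (by omega : 0 < k)
  refine ⟨_, hc g hg _ hmod, (r i + r j + c) / k, ?_, ?_⟩
  · simp only [Set.mem_Iic]
    by_contra hq
    have : k * 2 ≤ k * ((r i + r j + c) / k) := Nat.mul_le_mul_left k (by omega)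
    omega
  · funext v
    have : k * (v i + v j + (r i + r j + c) / k) + (r i + r j + c) % k =
        k * v i + r i + (k * v j + r j) + c := by
      simp only [mul_add]
      omega
    simp only [this]

/-! ### Regular sequences and counting -/

/-- A family of sequences whose values at `k * n + s` depend linearly on their values at `n`
consists of regular sequences. -/
theorem isRegular_of_vecMul {k : ℕ} (hk : 2 ≤ k) {d : ℕ} (c : ℕ → Fin d → ℕ)
    (μ : Fin k → Matrix (Fin d) (Fin d) ℕ)
    (h : ∀ n (s : Fin k), c (k * n + s) = Matrix.vecMul (c n) (μ s)) (p : Fin d) :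
    IsRegular k hk fun n => c n p := by
  have key : ∀ n, c n = Matrix.vecMul (c 0) ((baseRep k hk n).map μ).prod := by
    refine induction_on_digits hk (by simp [baseRep]) fun n s hns ih => ?_
    rw [h, baseRep_mul_add hk n s hns, ih]
    simp [Matrix.vecMul_vecMul]
  refine ⟨d, c 0, Pi.single p 1, μ, fun n => ?_⟩
  rw [Matrix.dotProduct_mulVec, ← key, dotProduct_single_one]

/-- The matrix of the digit `s` has as its `(q, p)` entry the number of `r` with `T p s r = q`. -/
theorem isRegular_of_recurrence {k : ℕ} (hk : 2 ≤ k) {I : Type*} [Finite I] (c : I → ℕ → ℕ)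
    (T : I → Fin k → Fin k → I) (h : ∀ p n (s : Fin k), c p (k * n + s) = ∑ r, c (T p s r) n)
    (p : I) : IsRegular k hk (c p) := by
  classical
  obtain ⟨d, ⟨e⟩⟩ := Finite.exists_equiv_fin I
  have := isRegular_of_vecMul hk (fun n q => c (e.symm q) n)
    (fun s => Matrix.of fun q p => ∑ r, if e (T (e.symm p) s r) = q then 1 else 0) ?_ (e p)
  · simpa using this
  · intro n s
    funext q
    simp only [h, Matrix.vecMul, dotProduct, Matrix.of_apply, Finset.mul_sum]
    rw [Finset.sum_comm]
    refine Finset.sum_congr rfl fun r _ => ?_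
    simp

theorem sum_range_mul_add {k : ℕ} (f : ℕ → ℕ) (n : ℕ) {m : ℕ} (hm : m ≤ k) :
    ∑ i ∈ Finset.range (k * n + m), f i =
      ∑ r : Fin k, ∑ i ∈ Finset.range (n + if (r : ℕ) < m then 1 else 0), f (k * i + r) := by
  have hblock : ∀ n, ∑ i ∈ Finset.range (k * n), f i =
      ∑ r : Fin k, ∑ i ∈ Finset.range n, f (k * i + r) := by
    intro n
    induction n with
    | zero => simp
    | succ n ih =>
      simp only [Finset.sum_range_succ, Finset.sum_add_distrib]
      rw [mul_add, mul_one, Finset.sum_range_add, ih]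
      congr 1
      exact Finset.sum_range fun r => f (k * n + r)
  have hlast : ∑ r ∈ Finset.range m, f (k * n + r) =
      ∑ r : Fin k, if (r : ℕ) < m then f (k * n + r) else 0 := by
    rw [← Finset.sum_range fun r => if r < m then f (k * n + r) else 0, ← Finset.sum_filter]
    refine Finset.sum_congr ?_ fun _ _ => rfl
    ext r
    simp only [Finset.mem_range, Finset.mem_filter]
    omega
  rw [Finset.sum_range_add, hblock, hlast, ← Finset.sum_add_distrib]
  refine Finset.sum_congr rfl fun r _ => ?_
  split_ifs <;> simp [Finset.sum_range_succ]

open Classical in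
/-- Counting the solutions `i ≤ n` of an automatic relation between `i` and `n` gives a regular
sequence. -/
theorem HasFiniteKernel.isRegular_count {k : ℕ} (hk : 2 ≤ k) {F : (Fin 2 → ℕ) → Prop}
    (hF : HasFiniteKernel k F) :
    IsRegular k hk fun n => Nat.count (fun i => F ![i, n]) (n + 1) := by
  obtain ⟨K, hK, hFK, hc⟩ := hF
  have : Finite K := hK
  have hdigit : ∀ r s : Fin k, ∀ i, (![(r : ℕ), (s : ℕ)] : Fin 2 → ℕ) i < k := by
    intro r s i
    fin_cases i <;> simp
  -- The Boolean `b` tells `i ≤ n` from `i < n`. With last digits `r` of `i` and `s` of `n`, the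
  -- leading parts are again compared by `≤` or `<`, according to whether `r < s + b`.
  let c : K × Bool → ℕ → ℕ := fun p n =>
    ∑ i ∈ Finset.range (n + if p.2 then 1 else 0), if p.1.1 ![i, n] then 1 else 0
  have hreg := isRegular_of_recurrence hk c
    (fun p s r => (⟨_, hc p.1.1 p.1.2 _ (hdigit r s)⟩,
      decide ((r : ℕ) < s + if p.2 then 1 else 0))) ?_ (⟨F, hFK⟩, true)
  · have he : (fun n => Nat.count (fun i => F ![i, n]) (n + 1)) = c (⟨F, hFK⟩, true) := by
      funext n
      simp [c, Nat.count_eq_card_filter_range]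
    rwa [he]
  · rintro ⟨G, b⟩ n s
    simp only [c]
    rw [add_assoc, sum_range_mul_add _ n (by have := s.2; split_ifs <;> omega)]
    refine Finset.sum_congr rfl fun r _ => ?_
    simp only [decide_eq_true_eq]
    refine Finset.sum_congr rfl fun i _ => ?_
    have : (fun l => k * (![i, n] : Fin 2 → ℕ) l + (![(r : ℕ), (s : ℕ)] : Fin 2 → ℕ) l) =
        ![k * i + r, k * n + s] := by
      funext l
      fin_cases l <;> simp
    exact if_congr (by rw [this]) rfl rfl

end Automata

/-! ### Commuting words and the lexicographic order -/

section Words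

variable {α : Type*}

/-- Commuting words are powers of a common word. -/
theorem exists_eq_flatten_replicate_of_append_comm (n : ℕ) :
    ∀ u v : List α, u.length + v.length ≤ n → u ++ v = v ++ u →
      ∃ (y : List α) (a b : ℕ),
        u = (List.replicate a y).flatten ∧ v = (List.replicate b y).flatten := by
  induction n with
  | zero =>
    intro u v hn _
    have hu : u = [] := List.length_eq_zero_iff.1 (by omega)
    have hv : v = [] := List.length_eq_zero_iff.1 (by omega)
    exact ⟨[], 0, 0, by simp [hu], by simp [hv]⟩
  | succ n ih =>
    have key : ∀ u v : List α, u.length + v.length ≤ n + 1 → u.length ≤ v.length →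
        u ++ v = v ++ u → ∃ (y : List α) (a b : ℕ),
          u = (List.replicate a y).flatten ∧ v = (List.replicate b y).flatten := by
      intro u v hn hl huv
      rcases u.eq_nil_or_concat with rfl | hu
      · exact ⟨v, 0, 1, by simp, by simp⟩
      have hpos : 0 < u.length := by
        obtain ⟨l, c, rfl⟩ := hu
        simp
      -- Euclid's algorithm on lengths: writing `v = u ++ v'`, the words `u` and `v'` commute again.
      have hp : u <+: v := List.prefix_of_prefix_length_le (l₃ := v ++ u)
        (by rw [← huv]; exact List.prefix_append u v) (List.prefix_append v u) hl
      obtain ⟨v', rfl⟩ := hp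
      rw [List.append_assoc] at huv
      have h' := List.append_cancel_left huv
      simp only [List.length_append] at hn
      obtain ⟨y, a, b, ha, hb⟩ := ih u v' (by omega) h'
      refine ⟨y, a, a + b, ha, ?_⟩
      rw [← List.replicate_append_replicate, List.flatten_append, ← ha, ← hb]
    intro u v hn huv
    rcases le_total u.length v.length with hl | hl
    · exact key u v hn hl huv
    · obtain ⟨y, a, b, ha, hb⟩ := key v u (by omega) hl huv.symm
      exact ⟨y, b, a, hb, ha⟩

theorem isPower_of_append_comm {u v : List α} (hu : u ≠ []) (hv : v ≠ [])
    (h : u ++ v = v ++ u) : IsPower (u ++ v) := by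
  obtain ⟨y, a, b, ha, hb⟩ := exists_eq_flatten_replicate_of_append_comm _ u v le_rfl h
  have ha0 : a ≠ 0 := by rintro rfl; exact hu (by simpa using ha)
  have hb0 : b ≠ 0 := by rintro rfl; exact hv (by simpa using hb)
  refine ⟨by simp [hu], y, a + b, by omega, ?_⟩
  rw [← List.replicate_append_replicate, List.flatten_append, ← ha, ← hb]

variable [LinearOrder α]

/-- `w` is smaller than `v` because of a smaller letter at the first position where they differ. -/
def LtByLetter (w v : List α) : Prop :=
  ∃ (p : List α) (a b : α) (s t : List α), w = p ++ a :: s ∧ v = p ++ b :: t ∧ a < b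

/-- This is what sets `LtByLetter` apart from `<`: arbitrary words may be appended on both sides. -/
theorem LtByLetter.append {w v : List α} (h : LtByLetter w v) (s t : List α) :
    LtByLetter (w ++ s) (v ++ t) := by
  obtain ⟨p, a, b, s', t', rfl, rfl, hab⟩ := h
  exact ⟨p, a, b, s' ++ s, t' ++ t, by simp, by simp, hab⟩

theorem LtByLetter.lt {w v : List α} (h : LtByLetter w v) : w < v := by
  obtain ⟨p, a, b, s, t, rfl, rfl, hab⟩ := h
  exact List.append_left_lt (List.Lex.rel hab)

theorem LtByLetter.append_lt {w v : List α} (h : LtByLetter w v) (s t : List α) :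
    w ++ s < v ++ t :=
  (h.append s t).lt

theorem isPrefix_or_ltByLetter_of_lt {w v : List α} (h : w < v) :
    w <+: v ∨ LtByLetter w v := by
  induction w generalizing v with
  | nil => exact Or.inl List.nil_prefix
  | cons a w ih =>
    cases v with
    | nil => exact absurd h (List.not_lt_nil _)
    | cons b v =>
      rcases List.cons_lt_cons_iff.1 h with hab | ⟨rfl, h'⟩
      · exact Or.inr ⟨[], a, b, w, v, rfl, rfl, hab⟩
      · rcases ih h' with hp | ⟨p, c, d, s, t, rfl, rfl, hcd⟩
        · exact Or.inl (List.cons_prefix_cons.2 ⟨rfl, hp⟩)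
        · exact Or.inr ⟨a :: p, c, d, s, t, rfl, rfl, hcd⟩

theorem ltByLetter_of_lt_of_length_le {w v : List α} (h : w < v) (hl : v.length ≤ w.length) :
    LtByLetter w v := by
  rcases isPrefix_or_ltByLetter_of_lt h with hp | hd
  · exact absurd h (by rw [hp.eq_of_length_le hl]; exact lt_irrefl v)
  · exact hd

theorem lt_append_of_ne_nil (w : List α) {v : List α} (h : v ≠ []) : w < w ++ v := by
  obtain ⟨a, v, rfl⟩ := List.exists_cons_of_ne_nil h
  simpa using List.append_left_lt (l₁ := w) (List.nil_lt_cons a v)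

theorem le_append_right (w v : List α) : w ≤ w ++ v := by
  rcases eq_or_ne v [] with rfl | h
  · simp
  · exact (lt_append_of_ne_nil w h).le

theorem append_lt_append_left_iff (p : List α) {w v : List α} : p ++ w < p ++ v ↔ w < v := by
  refine ⟨fun h => ?_, List.append_left_lt⟩
  by_contra hn
  rcases (not_lt.1 hn).eq_or_lt with rfl | hlt
  · exact lt_irrefl _ h
  · exact lt_asymm h (List.append_left_lt hlt)

theorem append_le_append_left_iff (p : List α) {w v : List α} : p ++ w ≤ p ++ v ↔ w ≤ v := by
  rw [← not_lt, ← not_lt, append_lt_append_left_iff]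

/-! ### Lyndon words and Lyndon factorizations -/

theorem IsLyndon.ne_nil {w : List α} (h : IsLyndon w) : w ≠ [] := h.1.1

/-- A Lyndon word is smaller than each of its proper nonempty suffixes. -/
theorem IsLyndon.lt_suffix {u v : List α} (h : IsLyndon (u ++ v)) (hu : u ≠ []) (hv : v ≠ []) :
    u ++ v < v := by
  by_contra hn
  have hul : 0 < u.length := List.length_pos_iff.2 hu
  have hvw : v < u ++ v := by
    refine lt_of_le_of_ne (not_lt.1 hn) fun he => ?_
    have := congrArg List.length he
    simp only [List.length_append] at this
    omega
  -- If `u ++ v = v ++ z`, minimality against the conjugates `v ++ u` and `z ++ v` forces `z = u`,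
  -- so `u` and `v` commute and the word is a power. Otherwise the conjugate `v ++ u` is already
  -- smaller.
  rcases isPrefix_or_ltByLetter_of_lt hvw with ⟨z, hz⟩ | hd
  · have hlen : z.length = u.length := by
      have := congrArg List.length hz
      simp only [List.length_append] at this
      omega
    have h1 : z ≤ u := by
      have := h.2 (v ++ u) ⟨u, v, rfl, rfl⟩
      rwa [← hz, append_le_append_left_iff] at this
    have h2 : u ≤ z := by
      have hle := h.2 (z ++ v) ⟨v, z, hz.symm, rfl⟩
      by_contra hzu
      exact absurd ((ltByLetter_of_lt_of_length_le (not_le.1 hzu) hlen.ge).append_lt v v)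
        (not_lt.2 hle)
    obtain rfl := le_antisymm h1 h2
    exact h.1.2 (isPower_of_append_comm hu hv hz.symm)
  · have := hd.append_lt u []
    rw [List.append_nil] at this
    exact absurd this (not_lt.2 (h.2 (v ++ u) ⟨u, v, rfl, rfl⟩))

theorem IsLyndon.ltByLetter_suffix {u v : List α} (h : IsLyndon (u ++ v)) (hu : u ≠ [])
    (hv : v ≠ []) : LtByLetter (u ++ v) v :=
  ltByLetter_of_lt_of_length_le (h.lt_suffix hu hv) (by simp)

/-- Converse of `IsLyndon.lt_suffix`. A power of `y` is excluded because its suffix `y` is also a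
proper prefix, hence smaller than the word. -/
theorem isLyndon_of_lt_suffix {w : List α} (hw : w ≠ [])
    (h : ∀ u v : List α, w = u ++ v → u ≠ [] → v ≠ [] → w < v) : IsLyndon w := by
  refine ⟨⟨hw, ?_⟩, ?_⟩
  · rintro ⟨-, y, m, hm, hy⟩
    obtain ⟨m, rfl⟩ := Nat.exists_eq_add_of_le hm
    have hy0 : y ≠ [] := by
      rintro rfl
      exact hw (by simpa using hy)
    have e1 : w = (List.replicate (m + 1) y).flatten ++ y := by
      rw [hy, show 2 + m = (m + 1) + 1 by omega, List.replicate_succ', List.flatten_append]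
      simp
    have e2 : w = y ++ (List.replicate (m + 1) y).flatten := by
      rw [hy, show 2 + m = (m + 1) + 1 by omega, List.replicate_succ, List.flatten_cons]
    have hne : (List.replicate (m + 1) y).flatten ≠ [] := by
      simp [List.replicate_succ, hy0]
    have h1 := h _ _ e1 hne hy0
    rw [e2] at h1
    exact lt_asymm h1 (lt_append_of_ne_nil y hne)
  · rintro z ⟨u, v, rfl, rfl⟩
    rcases eq_or_ne u [] with rfl | hu
    · simp
    rcases eq_or_ne v [] with rfl | hv
    · simp
    exact ((h u v rfl hu hv).trans_le (le_append_right v u)).le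

theorem isLyndon_singleton (a : α) : IsLyndon [a] := by
  refine isLyndon_of_lt_suffix (by simp) fun u v h hu hv => ?_
  have := congrArg List.length h
  have h1 := List.length_pos_iff.2 hu
  have h2 := List.length_pos_iff.2 hv
  simp only [List.length_append, List.length_singleton] at this
  omega

/-- The product of two Lyndon words in increasing order is a Lyndon word. -/
theorem IsLyndon.append {u v : List α} (hu : IsLyndon u) (hv : IsLyndon v) (h : u < v) :
    IsLyndon (u ++ v) := by
  have huv : u ++ v < v := by
    rcases isPrefix_or_ltByLetter_of_lt h with ⟨z, rfl⟩ | hd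
    · have hz : z ≠ [] := by
        rintro rfl
        simp at h
      exact (append_lt_append_left_iff u).2 (hv.lt_suffix hu.ne_nil hz)
    · simpa using hd.append_lt v []
  refine isLyndon_of_lt_suffix (by simp [hu.ne_nil]) fun p s hps hp hs => ?_
  rcases List.append_eq_append_iff.1 hps with ⟨z, rfl, hz⟩ | ⟨z, hz, rfl⟩
  · rcases eq_or_ne z [] with rfl | hz0
    · simp only [List.nil_append] at hz
      exact hz ▸ huv
    · subst hz
      exact huv.trans (hv.lt_suffix hz0 hs)
  · rcases eq_or_ne z [] with rfl | hz0
    · simpa using huv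
    · subst hz
      exact (hu.ltByLetter_suffix hp hz0).append_lt v v

/-- Prepending a Lyndon word to a word with a Lyndon factorization. -/
theorem exists_isLyndonFactorization_append {ws : List (List α)} :
    ∀ {u w : List α}, IsLyndon u → IsLyndonFactorization w ws →
      ∃ vs, IsLyndonFactorization (u ++ w) vs := by
  induction ws with
  | nil =>
    rintro u w hu ⟨rfl, -, -⟩
    exact ⟨[u], by simp, by simpa using hu, by simp⟩
  | cons v ws ih =>
    rintro u w hu ⟨rfl, hws, hc⟩
    rcases le_or_gt v u with hvu | huv
    · exact ⟨u :: v :: ws, by simp, by simpa [hu] using hws, List.isChain_cons_cons.2 ⟨hvu, hc⟩⟩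
    -- When `u < v`, the two merge into one Lyndon word, which is then compared with the next
    -- factor.
    · obtain ⟨vs, hvs⟩ := ih (hu.append (hws v (by simp)) huv)
        ⟨rfl, fun y hy => hws y (by simp [hy]), hc.tail⟩
      exact ⟨vs, by simpa using hvs⟩

theorem exists_isLyndonFactorization (w : List α) : ∃ ws, IsLyndonFactorization w ws := by
  induction w with
  | nil => exact ⟨[], by simp, by simp, by simp⟩
  | cons a w ih =>
    obtain ⟨ws, h⟩ := ih
    exact exists_isLyndonFactorization_append (isLyndon_singleton a) h

/-- A product of words that are at most the Lyndon word `u` decreases when `u` is removed. -/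
theorem IsLyndon.flatten_lt_append_flatten {u : List α} (hu : IsLyndon u) {ws : List (List α)}
    (h : ∀ y ∈ ws, y ≤ u) : ws.flatten < u ++ ws.flatten := by
  induction ws with
  | nil => simpa using lt_append_of_ne_nil [] hu.ne_nil
  | cons v ws ih =>
    have ih := ih fun y hy => h y (by simp [hy])
    rw [List.flatten_cons]
    rcases (h v (by simp)).eq_or_lt with rfl | hlt
    · exact List.append_left_lt ih
    rcases isPrefix_or_ltByLetter_of_lt hlt with ⟨z, rfl⟩ | hd
    · rcases eq_or_ne v [] with rfl | hv
      · simpa using ih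
      have hz : z ≠ [] := by
        rintro rfl
        simp at hlt
      rw [List.append_assoc]
      -- With `u = v ++ z` and `W = ws.flatten`, cancelling `v` leaves `W < z ++ v ++ W`. This
      -- follows from `W < u ++ W` and from `u` being smaller by letter than its suffix `z`.
      exact List.append_left_lt
        (ih.trans ((hu.ltByLetter_suffix hv hz).append_lt ws.flatten (v ++ ws.flatten)))
    · exact hd.append_lt _ _

theorem IsLyndonFactorization.of_cons {w v : List α} {ws : List (List α)}
    (h : IsLyndonFactorization w (v :: ws)) :
    IsLyndon v ∧ (∀ y ∈ ws, y ≤ v) ∧ w = v ++ ws.flatten ∧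
      IsLyndonFactorization ws.flatten ws := by
  obtain ⟨rfl, hws, hc⟩ := h
  refine ⟨hws v (by simp), ?_, rfl, rfl, fun y hy => hws y (by simp [hy]), hc.tail⟩
  have hp := List.isChain_iff_pairwise.1 hc
  exact (List.pairwise_cons.1 hp).1

theorem IsLyndon.append_lt_drop {v : List α} (hv : IsLyndon v) (r : List α) {i : ℕ} (hi : 0 < i)
    (hiv : i < v.length) : v ++ r < (v ++ r).drop i := by
  rw [List.drop_append_of_le_length hiv.le]
  have h1 : v.take i ≠ [] := by
    rw [← List.length_pos_iff, List.length_take]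
    omega
  have h2 : v.drop i ≠ [] := by
    rw [← List.length_pos_iff, List.length_drop]
    omega
  have hl : IsLyndon (v.take i ++ v.drop i) := by rwa [List.take_append_drop]
  have := (hl.ltByLetter_suffix h1 h2).append_lt r r
  rwa [List.take_append_drop] at this

/-- If `v'` were longer, the suffix at position `v.length` would start inside the Lyndon word `v'`
and so exceed the whole word; yet removing the first factor `v` decreases it. -/
theorem length_le_of_isLyndonFactorization {v v' : List α} {ws ws' : List (List α)}
    (h : IsLyndonFactorization (v ++ ws.flatten) (v :: ws)) (hv' : IsLyndon v')
    (he : v ++ ws.flatten = v' ++ ws'.flatten) : v'.length ≤ v.length := by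
  obtain ⟨hv, hle, -, -⟩ := h.of_cons
  by_contra hlt
  have h1 := hv'.append_lt_drop ws'.flatten (List.length_pos_iff.2 hv.ne_nil) (not_le.1 hlt)
  rw [← he, List.drop_left] at h1
  exact lt_asymm h1 (hv.flatten_lt_append_flatten hle)

theorem IsLyndonFactorization.unique {ws : List (List α)} :
    ∀ {w : List α} {ws' : List (List α)}, IsLyndonFactorization w ws →
      IsLyndonFactorization w ws' → ws = ws' := by
  induction ws with
  | nil =>
    rintro w ws' ⟨rfl, -, -⟩ h'
    cases ws' with
    | nil => rfl
    | cons v ws' =>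
      obtain ⟨hv, -, he, -⟩ := h'.of_cons
      simp [hv.ne_nil] at he
  | cons v ws ih =>
    intro w ws' h h'
    obtain ⟨hv, hle, rfl, ht⟩ := h.of_cons
    cases ws' with
    | nil => simpa [hv.ne_nil] using h'.1
    | cons v' ws' =>
      obtain ⟨hv', hle', he, ht'⟩ := h'.of_cons
      have hl : v.length = v'.length :=
        le_antisymm (length_le_of_isLyndonFactorization (he ▸ h') hv he.symm)
          (length_le_of_isLyndonFactorization h hv' he)
      obtain ⟨rfl, hf⟩ := List.append_inj he hl
      rw [ih ht (hf ▸ ht')]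

/-! ### Lyndon factors as suffix records -/

/-- The suffix of `w` at position `i` is smaller than all longer suffixes. -/
def IsSuffixRecord (w : List α) (i : ℕ) : Prop :=
  ∀ j < i, w.drop i < w.drop j

/-- Suffixes that start inside `v` are at least the whole word, which exceeds `ws.flatten`; they
impose no condition on later records. -/
theorem isSuffixRecord_append_iff {v : List α} {ws : List (List α)} (hv : IsLyndon v)
    (h : ∀ y ∈ ws, y ≤ v) (i : ℕ) :
    IsSuffixRecord (v ++ ws.flatten) (v.length + i) ↔ IsSuffixRecord ws.flatten i := by
  have hd : ∀ l, (v ++ ws.flatten).drop (v.length + l) = ws.flatten.drop l := fun l => by simp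
  refine ⟨fun H j hj => ?_, fun H j hj => ?_⟩
  · have := H (v.length + j) (by omega)
    rwa [hd, hd] at this
  · rw [hd]
    rcases lt_or_ge j v.length with hjv | hjv
    · have h1 : ws.flatten.drop i ≤ ws.flatten := by
        rcases Nat.eq_zero_or_pos i with rfl | hi
        · simp
        · simpa using (H 0 hi).le
      refine (h1.trans_lt (hv.flatten_lt_append_flatten h)).trans_le ?_
      rcases Nat.eq_zero_or_pos j with rfl | hj0
      · simp
      · exact (hv.append_lt_drop _ hj0 hjv).le
    · obtain ⟨l, rfl⟩ := Nat.exists_eq_add_of_le hjv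
      rw [hd]
      exact H l (by omega)

open Classical in
/-- The number of terms of a Lyndon factorization is the number of suffixes that are smaller than
all longer ones. -/
theorem IsLyndonFactorization.length_eq {ws : List (List α)} :
    ∀ {w : List α}, IsLyndonFactorization w ws →
      ws.length = Nat.count (IsSuffixRecord w) w.length := by
  induction ws with
  | nil =>
    rintro w ⟨rfl, -, -⟩
    simp
  | cons v ws ih =>
    intro w h
    obtain ⟨hv, hle, rfl, ht⟩ := h.of_cons
    have h1 : Nat.count (IsSuffixRecord (v ++ ws.flatten)) v.length = 1 := by
      obtain ⟨l, hl⟩ := Nat.exists_eq_succ_of_ne_zero (List.length_pos_iff.2 hv.ne_nil).ne'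
      rw [hl, Nat.succ_eq_add_one, Nat.count_succ', if_pos (by intro j hj; omega),
        Nat.add_eq_right, Nat.count_iff_forall_not]
      intro i hi hrec
      have := hrec 0 (by omega)
      rw [List.drop_zero] at this
      exact lt_asymm this (hv.append_lt_drop _ (by omega) (by omega))
    rw [List.length_append, Nat.count_add, h1, List.length_cons, ih ht, add_comm]
    simp only [isSuffixRecord_append_iff hv hle]

/-- Comparison of two suffixes, letter by letter. -/
theorem drop_prefixWord_lt_iff (x : ℕ → α) {n i j : ℕ} (hi : i ≤ n) (hj : j < i) :
    (prefixWord x n).drop i < (prefixWord x n).drop j ↔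
      ¬ (∃ s, i + s ≤ n ∧ x (i + s) ≠ x (j + s)) ∨
        ∃ t, i + t ≤ n ∧ x (i + t) < x (j + t) ∧ ¬ ∃ s, s < t ∧ x (i + s) ≠ x (j + s) := by
  have hlen : ∀ l, ((prefixWord x n).drop l).length = n + 1 - l := by
    intro l
    simp [prefixWord]
  have hget : ∀ l s (h : s < ((prefixWord x n).drop l).length),
      ((prefixWord x n).drop l)[s] = x (l + s) := by
    intro l s h
    simp [prefixWord]
  rw [List.lt_iff_exists]
  -- As `j < i`, the suffix at `i` is the shorter one: it is either a proper prefix of the other or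
  -- smaller at the first mismatch `t`.
  refine or_congr ?_ ?_
  · constructor
    · rintro ⟨he, -⟩ ⟨s, hs, hne⟩
      refine hne ?_
      have hs' : s < ((prefixWord x n).drop i).length := by rw [hlen]; omega
      have hs'' : s < ((prefixWord x n).drop j).length := by rw [hlen]; omega
      have e := List.getElem_of_eq he hs'
      rw [List.getElem_take, hget, hget] at e
      exact e
    · intro H
      push Not at H
      refine ⟨List.ext_getElem (by simp only [List.length_take, hlen]; omega) ?_, ?_⟩
      · intro s h1 h2
        rw [List.getElem_take, hget, hget]
        exact H s (by rw [hlen] at h1; omega)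
      · rw [hlen, hlen]; omega
  · constructor
    · rintro ⟨t, h1, h2, heq, hlt⟩
      rw [hget, hget] at hlt
      refine ⟨t, by rw [hlen] at h1; omega, hlt, ?_⟩
      rintro ⟨s, hs, hne⟩
      have := heq s hs
      rw [hget, hget] at this
      exact hne this
    · rintro ⟨t, ht, hlt, H⟩
      push Not at H
      refine ⟨t, by rw [hlen]; omega, by rw [hlen]; omega, ?_, ?_⟩
      · intro s hs
        rw [hget, hget]
        exact H s hs
      · rw [hget, hget]
        exact hlt

end Words

/-- The suffix of `x[0..n]` at position `i` being smaller than all longer suffixes is an automatic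
relation between `i` and `n`. -/
theorem IsAutomatic.hasFiniteKernel_isSuffixRecord {α : Type*} [LinearOrder α] {k : ℕ}
    {hk : 2 ≤ k} {x : ℕ → α} (hx : IsAutomatic k hk x) :
    ∃ F : (Fin 2 → ℕ) → Prop, HasFiniteKernel k F ∧
      ∀ n, ∀ i ≤ n, F ![i, n] ↔ IsSuffixRecord (prefixWord x n) i := by
  -- variables: 0 is `i`, 1 is `n`, 2 is `j`, 3 is `t`, 4 is `s`
  have hdiff : HasFiniteKernel k fun v : Fin 5 → ℕ => x (v 0 + v 4) ≠ x (v 2 + v 4) :=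
    (hx.hasFiniteKernel_add 0 4).comp₂ (hx.hasFiniteKernel_add 2 4) (· ≠ ·)
  have hlt : HasFiniteKernel k fun v : Fin 5 → ℕ => x (v 0 + v 3) < x (v 2 + v 3) :=
    (hx.hasFiniteKernel_add 0 3).comp₂ (hx.hasFiniteKernel_add 2 3) (· < ·)
  have hprefix := (((hasFiniteKernel_add_le hk 0 4 1).and hdiff).exists hk 4).not
  have hletter := ((hasFiniteKernel_add_le hk 0 3 1).and
    (hlt.and (((hasFiniteKernel_lt 4 3).and hdiff).exists hk 4).not)).exists hk 3
  have hall := (((hasFiniteKernel_lt 2 0).and (hprefix.or hletter).not).exists hk 2).not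
  -- Variables 2, 3 and 4 are bound, hence overwritten by `Function.update`; the value substituted
  -- for them is irrelevant.
  refine ⟨_, hall.subst ![0, 1, 0, 0, 0], fun n i hi => ?_⟩
  have hrec : IsSuffixRecord (prefixWord x n) i ↔
      ¬ ∃ j, j < i ∧ ¬ (prefixWord x n).drop i < (prefixWord x n).drop j := by
    simp only [IsSuffixRecord]
    push Not
    rfl
  rw [hrec]
  refine not_congr (exists_congr fun j => and_congr_right' ?_ |>.trans <|
    and_congr_right fun hj => not_congr (drop_prefixWord_lt_iff x hi hj).symm)
  simp [Function.update]

end LyndonAutomatic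

open LyndonAutomatic in
theorem theorem19 {α : Type*} [LinearOrder α] (k : ℕ) (hk : 2 ≤ k) (x : ℕ → α)
    (hx : LyndonAutomatic.IsAutomatic k hk x) :
    ∃ f : ℕ → ℕ,
      (∀ n, (∃! ws, LyndonAutomatic.IsLyndonFactorization (LyndonAutomatic.prefixWord x n) ws) ∧
        ∀ ws, LyndonAutomatic.IsLyndonFactorization (LyndonAutomatic.prefixWord x n) ws →
          f n = ws.length) ∧
      LyndonAutomatic.IsRegular k hk f := by
  classical
  obtain ⟨F, hF, hFx⟩ := hx.hasFiniteKernel_isSuffixRecord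
  refine ⟨_, fun n => ⟨?_, fun ws hws => ?_⟩, hF.isRegular_count hk⟩
  · obtain ⟨ws, hws⟩ := exists_isLyndonFactorization (prefixWord x n)
    exact ⟨ws, hws, fun ws' hws' => hws'.unique hws⟩
  · have hlen : (prefixWord x n).length = n + 1 := by simp [prefixWord]
    rw [hws.length_eq, hlen, Nat.count_eq_card_filter_range, Nat.count_eq_card_filter_range]
    refine congrArg Finset.card (Finset.filter_congr fun i hi => ?_)
    exact hFx n i (Nat.lt_succ_iff.1 (Finset.mem_range.1 hi))
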